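/- Let $X\subset\mathbb P^n(\mathbb C)$ be a smooth complex projective surface with its classical topology, and let $V=V_1\cup\dots\cup V_k\subset X$ be an algebraic curve whose irreducible components $V_1,\dots,V_k$ are distinct smooth curves intersecting in normal crossings, i.e. near every point of $V_i\cap V_j$ ($i\ne j$) the pair $(X,V)$ is locally biholomorphic to $(\mathbb C^2,\{x=0\}\cup\{y=0\})$. Let $Q=\bigcup_{i\neq j}V_i\cap V_j$. For each $i$ let $T(V_i)\subset X$ be an embedded closed tubular neighborhood of $V_i$, that is, the image of the closed unit disc bundle of a real plane bundle with fibrewise inner product over $V_i$ under a topological embedding that is the inclusion on the zero section and maps the open unit disc bundle onto an open set $T^\circ(V_i)$; let $p_i:T(V_i)\to V_i$ be the projection and $S(V_i)\subset T(V_i)$ the unit circle bundle. Assume that there are pairwise disjoint neighborhoods $N(q)$ of the points $q\in Q$ such that $T(V_i)\cap T(V_j)=\bigcup_{q\in V_i\cap V_j}N(q)$ for $i\neq j$, and that for $q\in V_i\cap V_j$, $i\ne j$, one has $p_i^{-1}(V_i\cap N(q))=N(q)=p_j^{-1}(V_j\cap N(q))$ and there is a homeomorphism $$N(q)\cong\{|x|\le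 1\}\times\{|y|\le 1\}$$ taking $q$ to $(0,0)$, $V_i\cap N(q)$ to $\{y=0\}$, $V_j\cap N(q)$ to $\{x=0\}$, $S(V_i)\cap N(q)$ to $\{|y|=1\}$, $S(V_j)\cap N(q)$ to $\{|x|=1\}$, and $p_i$, $p_j$ to $(x,y)\mapsto(x,0)$, $(x,y)\mapsto(0,y)$. Put $$T(V)=\bigcup_{i=1}^k T(V_i),\qquad V_i^c=V_i\setminus\bigcup_{j\ne i}\bigl(T^\circ(V_i)\cap T^\circ(V_j)\bigr),\qquad S(V)=\bigcup_{i=1}^k S(V_i)\cap p_i^{-1}(V_i^c).$$ Then $S(V)\subset T(V)\setminus V$, and $T(V)\setminus V$ has a (strong) deformation retraction to $S(V)$: there is a continuous map $H:[0,1]\times(T(V)\setminus V)\to T(V)\setminus V$ with $H(0,z)=z$ and $H(1,z)\in S(V)$ for all $z\in T(V)\setminus V$, and $H(t,s)=s$ for all $s\in S(V)$ and $t\in[0,1]$. -/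

import Mathlib

open Set Topology Bundle
open scoped LinearAlgebra.Projectivization unitInterval

noncomputable section

/-! ### Complex projective space and its smooth projective subvarieties -/

/-- Complex projective `n`-space, as a set of lines in `ℂ ^ (n + 1)`. -/
abbrev PSpace (n : ℕ) : Type := ℙ ℂ (Fin (n + 1) → ℂ)

/-- The complex (classical) topology of projective space: the quotient topology from
`ℂ ^ (n + 1) ∖ {0}`. -/
instance PSpace.topologicalSpace (n : ℕ) : TopologicalSpace (PSpace n) :=
  TopologicalSpace.coinduced (Projectivization.mk' ℂ)
    (inferInstance : TopologicalSpace {v : Fin (n + 1) → ℂ // v ≠ 0})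

/-- A homogeneous polynomial (of some degree) in `n + 1` variables. -/
def IsForm {n : ℕ} (f : MvPolynomial (Fin (n + 1)) ℂ) : Prop := ∃ d : ℕ, f.IsHomogeneous d

/-- The form `f` vanishes at the point `p`. For a homogeneous `f` this does not depend on the
chosen homogeneous coordinates of `p`. -/
def VanishesAt {n : ℕ} (f : MvPolynomial (Fin (n + 1)) ℂ) (p : PSpace n) : Prop :=
  MvPolynomial.eval p.rep f = 0

/-- A projective algebraic set: the common zero set of a set of forms. -/
def IsProjAlgebraic {n : ℕ} (Z : Set (PSpace n)) : Prop :=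
  ∃ S : Set (MvPolynomial (Fin (n + 1)) ℂ), (∀ f ∈ S, IsForm f) ∧
    Z = {p | ∀ f ∈ S, VanishesAt f p}

/-- `Z` is nonempty and irreducible in the Zariski topology. -/
def IsZariskiIrreducible {n : ℕ} (Z : Set (PSpace n)) : Prop :=
  Z.Nonempty ∧ ∀ A B : Set (PSpace n), IsProjAlgebraic A → IsProjAlgebraic B →
    Z ⊆ A ∪ B → Z ⊆ A ∨ Z ⊆ B

/-- `Z` is a smooth projective algebraic set, all of whose components have dimension `d`: near each
of its points (in the Zariski topology) it is cut out by `n - d` forms whose differentials at that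
point are linearly independent. -/
def IsSmoothProjective {n : ℕ} (d : ℕ) (Z : Set (PSpace n)) : Prop :=
  IsProjAlgebraic Z ∧ ∀ p ∈ Z, ∃ (m : ℕ) (f : Fin m → MvPolynomial (Fin (n + 1)) ℂ)
    (g : MvPolynomial (Fin (n + 1)) ℂ),
    m + d = n ∧ (∀ a, IsForm (f a)) ∧ IsForm g ∧ ¬ VanishesAt g p ∧
    LinearIndependent ℂ
      (fun a : Fin m => fun b : Fin (n + 1) =>
        MvPolynomial.eval p.rep (MvPolynomial.pderiv b (f a))) ∧
    ∀ w : PSpace n, ¬ VanishesAt g w → (w ∈ Z ↔ ∀ a, VanishesAt (f a) w)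

/-! ### Curves with normal crossings on a surface -/

/-- `φ` is a biholomorphic map from the open set `W ⊆ ℂ²` onto an open subset of the surface `X`:
it is a homeomorphism onto an open subset of `X`, it is given in homogeneous coordinates by a
holomorphic map `F`, and it is an immersion into projective space. -/
def IsHolomorphicParametrization {n : ℕ} (X : Set (PSpace n)) (W : Set (ℂ × ℂ)) (φ : W → X) :
    Prop :=
  IsOpen W ∧ IsOpenEmbedding φ ∧
    ∃ F : ℂ × ℂ → (Fin (n + 1) → ℂ), DifferentiableOn ℂ F W ∧
      ∀ w : W, (∃ h : F w ≠ 0, (φ w : PSpace n) = Projectivization.mk ℂ (F w) h) ∧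
        ∀ u : ℂ × ℂ, fderiv ℂ F w u ∈ Submodule.span ℂ {F w} → u = 0

/-- The sets `C i` are the irreducible components of an algebraic curve `⋃ i, C i` on `X`; they are
smooth, and they intersect in normal crossings: near each point of intersection, the pair
`(X, ⋃ i, C i)` is locally isomorphic to `(ℂ², {x = 0} ∪ {y = 0})`. -/
structure IsNormalCrossingCurve {n k : ℕ} (X : Set (PSpace n)) (C : Fin k → Set X) : Prop where
  injective : Function.Injective C
  irreducible : ∀ i, IsZariskiIrreducible ((↑) '' C i : Set (PSpace n))
  smooth : ∀ i, IsSmoothProjective 1 ((↑) '' C i : Set (PSpace n))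
  crossing : ∀ i j, i ≠ j → ∀ q ∈ C i ∩ C j,
    ∃ (W : Set (ℂ × ℂ)) (φ : W → X) (h0 : (0 : ℂ × ℂ) ∈ W),
      IsHolomorphicParametrization X W φ ∧ φ ⟨0, h0⟩ = q ∧
      ∀ w : W, φ w ∈ ⋃ l, C l ↔ (w : ℂ × ℂ).1 = 0 ∨ (w : ℂ × ℂ).2 = 0

/-! ### Tubular neighbourhoods -/

/-- An embedded (closed) tubular neighbourhood of `C` in `M`, of codimension two: an embedding in
`M` of the closed unit disc bundle of a real plane bundle `E` over `C` with a continuous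
fibrewise inner product, which is the inclusion of `C` on the zero section and carries the open unit
disc bundle onto an open subset of `M`. -/
structure TubularNbhd {M : Type*} [TopologicalSpace M] (C : Set M) where
  E : C → Type
  [topTotal : TopologicalSpace (TotalSpace ℂ E)]
  [normed : ∀ c, NormedAddCommGroup (E c)]
  [inner : ∀ c, InnerProductSpace ℝ (E c)]
  [fiberBundle : FiberBundle ℂ E]
  [vectorBundle : VectorBundle ℝ ℂ E]
  [riemannian : IsContinuousRiemannianBundle ℂ E]
  emb : {e : TotalSpace ℂ E // ‖e.2‖ ≤ 1} → M
  isEmbedding : IsEmbedding emb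
  emb_zero : ∀ c : C, emb ⟨⟨c, 0⟩, by simp⟩ = c
  isOpen_image : IsOpen (emb '' {e | ‖e.1.2‖ < 1})

attribute [instance] TubularNbhd.topTotal TubularNbhd.normed TubularNbhd.inner
  TubularNbhd.fiberBundle TubularNbhd.vectorBundle TubularNbhd.riemannian

namespace TubularNbhd

variable {M : Type*} [TopologicalSpace M] {C : Set M}

/-- The closed unit disc bundle. -/
abbrev Disc (T : TubularNbhd C) : Type _ := {e : TotalSpace ℂ T.E // ‖e.2‖ ≤ 1}

/-- The distance `‖e‖` of a point of the disc bundle from the zero section. -/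
def radius (T : TubularNbhd C) (e : T.Disc) : ℝ := ‖e.1.2‖

/-- The point of `C` over which a point of the disc bundle lies. -/
def base (T : TubularNbhd C) (e : T.Disc) : M := (e.1.1 : M)

/-- The closed tubular neighbourhood, as a subset of `M`. -/
def closedTube (T : TubularNbhd C) : Set M := range T.emb

/-- The open tubular neighbourhood, as a subset of `M`. -/
def openTube (T : TubularNbhd C) : Set M := T.emb '' {e | T.radius e < 1}

/-- The boundary circle bundle restricted to `B ⊆ C`. -/
def circleBundle (T : TubularNbhd C) (B : Set M) : Set M :=
  T.emb '' {e | T.radius e = 1 ∧ T.base e ∈ B}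

end TubularNbhd

/-- The closed unit disc in `ℂ`. -/
abbrev ClosedDisc : Type := {z : ℂ // ‖z‖ ≤ 1}

/-- The centre of the closed unit disc. -/
def ClosedDisc.centre : ClosedDisc := ⟨0, by simp⟩

/-- `g` is a homeomorphism from the bidisc `{|x| ≤ 1} × {|y| ≤ 1}` onto the neighbourhood `N` of the
crossing point `q` of `C` and `C'`, which takes `(0, 0)` to `q`, the disc `{y = 0}` onto `C ∩ N` and
the disc `{x = 0}` onto `C' ∩ N`. On `N` the projection of the first tubular neighbourhood is
`(x, y) ↦ (x, 0)` and its circle bundle is `{|y| = 1}`, the projection of the second one is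
`(x, y) ↦ (0, y)` and its circle bundle is `{|x| = 1}`, and `N` is the full part of each tubular
neighbourhood over `C ∩ N`, respectively over `C' ∩ N`. -/
structure IsBidiscChart {M : Type*} [TopologicalSpace M] {C C' : Set M}
    (T : TubularNbhd C) (T' : TubularNbhd C') (q : M) (N : Set M)
    (g : ClosedDisc × ClosedDisc → M) : Prop where
  isEmbedding : IsEmbedding g
  range_eq : range g = N
  map_centre : g (ClosedDisc.centre, ClosedDisc.centre) = q
  mem_left : ∀ x y, g (x, y) ∈ C ↔ y = ClosedDisc.centre
  mem_right : ∀ x y, g (x, y) ∈ C' ↔ x = ClosedDisc.centre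
  base_left : ∀ e x y, T.emb e = g (x, y) → T.base e = g (x, ClosedDisc.centre)
  base_right : ∀ e x y, T'.emb e = g (x, y) → T'.base e = g (ClosedDisc.centre, y)
  radius_left : ∀ e x y, T.emb e = g (x, y) → (T.radius e = 1 ↔ ‖(y : ℂ)‖ = 1)
  radius_right : ∀ e x y, T'.emb e = g (x, y) → (T'.radius e = 1 ↔ ‖(x : ℂ)‖ = 1)
  saturated_left : ∀ e, T.base e ∈ N → T.emb e ∈ N
  saturated_right : ∀ e, T'.base e ∈ N → T'.emb e ∈ N

/-- A choice of tubular neighbourhoods of the subsets `C i` of `M`, such that two of them only meet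
near the points `q` at which the corresponding subsets intersect, in pairwise disjoint
neighbourhoods `N q` of these points, each of which is a bidisc. -/
structure TubularSystem {M : Type*} [TopologicalSpace M] {ι : Type*} (C : ι → Set M) where
  tube : ∀ i, TubularNbhd (C i)
  N : M → Set M
  N_mem_nhds : ∀ i j, i ≠ j → ∀ q ∈ C i ∩ C j, N q ∈ 𝓝 q
  N_disjoint : ∀ i j i' j', i ≠ j → i' ≠ j' → ∀ q ∈ C i ∩ C j, ∀ q' ∈ C i' ∩ C j',
    q ≠ q' → Disjoint (N q) (N q')
  tube_inter : ∀ i j, i ≠ j →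
    (tube i).closedTube ∩ (tube j).closedTube = ⋃ q ∈ C i ∩ C j, N q
  chart : ∀ i j, i ≠ j → ∀ q ∈ C i ∩ C j,
    ∃ g : ClosedDisc × ClosedDisc → M, IsBidiscChart (tube i) (tube j) q (N q) g

namespace TubularSystem

variable {M : Type*} [TopologicalSpace M] {ι : Type*} {C : ι → Set M}

/-- The tubular neighbourhood `T(V)` of `V = ⋃ i, C i`. -/
def nbhd (T : TubularSystem C) : Set M := ⋃ i, (T.tube i).closedTube

/-- The curve `C i` with the open bidiscs about its crossing points removed. -/
def core (T : TubularSystem C) (i : ι) : Set M :=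
  C i \ ⋃ (j : ι) (_ : j ≠ i), (T.tube i).openTube ∩ (T.tube j).openTube

/-- The boundary manifold `S(V)`: the union of the circle bundles over the sets `T.core i`. -/
def boundary (T : TubularSystem C) : Set M := ⋃ i, (T.tube i).circleBundle (T.core i)

end TubularSystem

/-- The subset `S` of `A` is a (strong) deformation retract of `A`. -/
def HasDeformationRetraction {M : Type*} [TopologicalSpace M] (A S : Set M) : Prop :=
  S ⊆ A ∧ ∃ H : C(I × A, A), (∀ x, H (0, x) = x) ∧ (∀ x, (H (1, x) : M) ∈ S) ∧
    ∀ (t : I) (x : A), (x : M) ∈ S → H (t, x) = x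

end

/-!
Pushing every point of the punctured tube `T(V_i) ∖ V_i` radially to the circle bundle `S(V_i)`,
and fixing all points outside `T(V_i)`, deforms `T(V) ∖ V` out of the open tube `T°(V_i)`. This
push moves points along the fibres of `p_i`. In a bidisc at a point of `V_i ∩ V_j` these fibres are
the discs `{x = const}`, while `V_j` is `{x = 0}` and `T°(V_j)` is `{|x| < 1}`; so the push for
`V_i` respects both `V_j` and `T°(V_j)`, and performing the pushes for all `i` one after the other
moves every point out of all the open tubes. What remains of `T(V)` outside these is `S(V)`.
-/

/-- `H` is a strong deformation retraction of the whole space `A` onto its subset `S`, with the time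
as first variable. -/
structure IsStrongDeformation {A : Type*} [TopologicalSpace A] (S : Set A) (H : C(I × A, A)) :
    Prop where
  map_zero : ∀ x, H (0, x) = x
  map_one_mem : ∀ x, H (1, x) ∈ S
  map_eq_self : ∀ t, ∀ x ∈ S, H (t, x) = x

namespace IsStrongDeformation

variable {A : Type*} [TopologicalSpace A]

theorem comp {S S' : Set A} {H G : C(I × A, A)} (hG : IsStrongDeformation S' G)
    (hH : IsStrongDeformation S H) (hGS : ∀ t, MapsTo (fun x => G (t, x)) S S) :
    IsStrongDeformation (S' ∩ S) (G.comp (ContinuousMap.fst.prodMk H)) where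
  map_zero x := by simp [hH.map_zero, hG.map_zero]
  map_one_mem x := ⟨hG.map_one_mem _, hGS 1 (hH.map_one_mem x)⟩
  map_eq_self t x hx := by simp [hH.map_eq_self t x hx.2, hG.map_eq_self t x hx.1]

theorem exists_iInter {ι : Type*} [Finite ι] {S : ι → Set A} {G : ι → C(I × A, A)}
    (hG : ∀ i, IsStrongDeformation (S i) (G i))
    (hGS : ∀ i j, i ≠ j → ∀ t, MapsTo (fun x => G i (t, x)) (S j) (S j)) :
    ∃ H, IsStrongDeformation (⋂ i, S i) H := by
  classical
  have := Fintype.ofFinite ι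
  suffices h : ∀ s : Finset ι, ∃ H, IsStrongDeformation (⋂ i ∈ s, S i) H by
    simpa using h Finset.univ
  intro s
  induction s using Finset.induction_on with
  | empty => exact ⟨ContinuousMap.snd, by simp, by simp, by simp⟩
  | insert i s hi ih =>
    obtain ⟨H, hH⟩ := ih
    rw [Finset.set_biInter_insert]
    refine ⟨_, (hG i).comp hH fun t x hx => mem_iInter₂.2 fun j hj => ?_⟩
    exact hGS i j (ne_of_mem_of_not_mem hj hi).symm t (mem_iInter₂.1 hx j hj)

theorem hasDeformationRetraction {M : Type*} [TopologicalSpace M] {A S : Set M} (hSA : S ⊆ A)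
    {H : C(I × A, A)} (hH : IsStrongDeformation ((↑) ⁻¹' S) H) : HasDeformationRetraction A S :=
  ⟨hSA, H, hH.map_zero, hH.map_one_mem, hH.map_eq_self⟩

end IsStrongDeformation

theorem continuousOn_of_subset_union_isClosed {X Y : Type*} [TopologicalSpace X]
    [TopologicalSpace Y] {f : X → Y} {A s t : Set X} (hs : IsClosed s) (ht : IsClosed t)
    (hA : A ⊆ s ∪ t) (hfs : ContinuousOn f (A ∩ s)) (hft : ContinuousOn f (A ∩ t)) :
    ContinuousOn f A := by
  have within {u : Set X} (hu : IsClosed u) (hfu : ContinuousOn f (A ∩ u)) {x : X} (hx : x ∈ A) :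
      ContinuousWithinAt f (A ∩ u) x := by
    by_cases hxu : x ∈ u
    · exact hfu x ⟨hx, hxu⟩
    · exact continuousWithinAt_of_notMem_closure fun h =>
        hxu (closure_minimal inter_subset_right hu h)
  refine fun x hx => ((within hs hfs hx).union (within ht hft hx)).mono ?_
  rw [← inter_union_distrib_left]
  exact subset_inter subset_rfl hA

theorem continuous_smul_totalSpace {𝕜 B F : Type*} {E : B → Type*} [NontriviallyNormedField 𝕜]
    [TopologicalSpace B] [NormedAddCommGroup F] [NormedSpace 𝕜 F]
    [TopologicalSpace (TotalSpace F E)] [∀ b, AddCommMonoid (E b)] [∀ b, Module 𝕜 (E b)]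
    [∀ b, TopologicalSpace (E b)] [FiberBundle F E] [VectorBundle 𝕜 F E] :
    Continuous fun p : 𝕜 × TotalSpace F E => (⟨p.2.1, p.1 • p.2.2⟩ : TotalSpace F E) := by
  rw [continuous_iff_continuousAt]
  rintro ⟨a, e⟩
  rw [FiberBundle.continuousAt_totalSpace]
  refine ⟨((FiberBundle.continuous_proj F E).comp continuous_snd).continuousAt, ?_⟩
  set τ := trivializationAt F E e.1
  have he : e ∈ τ.source := FiberBundle.mem_trivializationAt_proj_source
  have hτ : ContinuousAt (fun p : 𝕜 × TotalSpace F E => p.1 • (τ p.2).2) (a, e) :=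
    continuousAt_fst.smul <| continuousAt_snd.comp <|
      (τ.toOpenPartialHomeomorph.continuousAt he).comp continuousAt_snd
  refine hτ.congr ?_
  filter_upwards [continuousAt_snd (τ.open_source.mem_nhds he)] with p hp
  exact ((τ.linear 𝕜 (τ.mem_source.1 hp)).map_smul p.1 p.2.2).symm

section RiemannianBundle

variable {B F : Type*} [TopologicalSpace B] [NormedAddCommGroup F] [NormedSpace ℝ F]
  {E : B → Type*} [TopologicalSpace (TotalSpace F E)] [∀ b, NormedAddCommGroup (E b)]
  [∀ b, InnerProductSpace ℝ (E b)] [FiberBundle F E] [VectorBundle ℝ F E]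
  [IsContinuousRiemannianBundle F E]

theorem continuous_norm_totalSpace : Continuous fun e : TotalSpace F E => ‖e.2‖ := by
  have h : Continuous fun e : TotalSpace F E => inner ℝ e.2 e.2 :=
    Continuous.inner_bundle (b := fun e : TotalSpace F E => e.1) (F := F)
      (v := fun e => e.2) (w := fun e => e.2) continuous_id continuous_id
  simpa only [norm_eq_sqrt_real_inner] using h.sqrt

theorem eventually_norm_trivializationAt_snd_le (b : B) (r : ℝ) :
    ∃ R, ∀ᶠ b' in 𝓝 b, ∀ v : E b', ‖v‖ ≤ r → ‖(trivializationAt F E b ⟨b', v⟩).2‖ ≤ R := by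
  obtain ⟨K, -, hbd⟩ := eventually_norm_trivializationAt_lt F E b
  refine ⟨K * r, ?_⟩
  filter_upwards [hbd, (trivializationAt F E b).open_baseSet.mem_nhds
    (FiberBundle.mem_baseSet_trivializationAt' b)] with b' hb' hmem v hv
  have h := ((trivializationAt F E b).continuousLinearMapAt ℝ b').le_of_opNorm_le_of_le hb'.le hv
  rwa [Trivialization.continuousLinearMapAt_apply_of_mem _ _ hmem] at h

theorem isCompact_setOf_norm_snd_le [CompactSpace B] [ProperSpace F] (r : ℝ) :
    IsCompact {e : TotalSpace F E | ‖e.2‖ ≤ r} := by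
  rw [isCompact_iff_ultrafilter_le_nhds']
  intro u hu
  obtain ⟨b, -, hb⟩ := isCompact_univ.ultrafilter_le_nhds (u.map (π F E)) (by simp)
  have hb : Filter.Tendsto (π F E) u (𝓝 b) := hb
  set τ := trivializationAt F E b
  have hτ : b ∈ τ.baseSet := FiberBundle.mem_baseSet_trivializationAt' b
  obtain ⟨R, hR⟩ := eventually_norm_trivializationAt_snd_le (F := F) (E := E) b r
  have hball : ∀ᶠ e in (u : Filter (TotalSpace F E)), (τ e).2 ∈ Metric.closedBall (0 : F) R := by
    filter_upwards [hu, hb hR] with e he hle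
    exact mem_closedBall_zero_iff.2 (hle e.2 he)
  obtain ⟨v, -, hv⟩ := (isCompact_closedBall (0 : F) R).ultrafilter_le_nhds'
    (u.map fun e => (τ e).2) hball
  have hmem : τ.toOpenPartialHomeomorph.symm (b, v) ∈ τ.source := τ.map_target (τ.mem_target.2 hτ)
  have hlim : (u : Filter (TotalSpace F E)) ≤ 𝓝 (τ.toOpenPartialHomeomorph.symm (b, v)) := by
    refine (τ.tendsto_nhds_iff (f := id) hmem).2 ⟨?_, ?_⟩
    · rwa [τ.proj_symm_apply' hτ]
    · rwa [τ.apply_symm_apply' hτ]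
  exact ⟨_, (isClosed_le continuous_norm_totalSpace continuous_const).mem_of_tendsto hlim hu, hlim⟩

end RiemannianBundle

namespace TubularNbhd

variable {M : Type*} [TopologicalSpace M] {C : Set M} (T : TubularNbhd C)

theorem emb_injective : Function.Injective T.emb := T.isEmbedding.injective

theorem continuous_radius : Continuous T.radius :=
  continuous_norm_totalSpace.comp continuous_subtype_val

theorem radius_le_one (e : T.Disc) : T.radius e ≤ 1 := e.2

theorem radius_nonneg (e : T.Disc) : 0 ≤ T.radius e := norm_nonneg _

/-- The zero section of the disc bundle. -/
def zero (c : C) : T.Disc := ⟨⟨c, 0⟩, by simp⟩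

theorem emb_zero_apply (c : C) : T.emb (T.zero c) = c := T.emb_zero c

theorem radius_zero (c : C) : T.radius (T.zero c) = 0 := norm_zero

theorem eq_zero_of_radius_eq_zero {e : T.Disc} (he : T.radius e = 0) : e = T.zero e.1.1 := by
  obtain ⟨⟨c, v⟩, hv⟩ := e
  obtain rfl : v = 0 := norm_eq_zero.1 he
  rfl

theorem emb_mem_iff {e : T.Disc} : T.emb e ∈ C ↔ T.radius e = 0 := by
  constructor
  · intro h
    rw [T.emb_injective (T.emb_zero_apply ⟨_, h⟩).symm, radius_zero]
  · intro h
    rw [T.eq_zero_of_radius_eq_zero h, emb_zero_apply]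
    exact e.1.1.2

theorem emb_mem_openTube_iff {e : T.Disc} : T.emb e ∈ T.openTube ↔ T.radius e < 1 :=
  T.emb_injective.mem_set_image

theorem openTube_subset_closedTube : T.openTube ⊆ T.closedTube := image_subset_range _ _

theorem subset_openTube : C ⊆ T.openTube := fun c hc =>
  ⟨T.zero ⟨c, hc⟩, by simp [radius_zero], T.emb_zero_apply ⟨c, hc⟩⟩

theorem image_radius_ne_zero : T.emb '' {e | T.radius e ≠ 0} = Cᶜ ∩ T.closedTube := by
  have : {e | T.radius e ≠ 0} = T.emb ⁻¹' Cᶜ := ext fun e => T.emb_mem_iff.not.symm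
  rw [this, image_preimage_eq_inter_range, closedTube]

theorem isClosed_closedTube [T2Space M] (hC : IsCompact C) : IsClosed T.closedTube := by
  have : CompactSpace C := isCompact_iff_compactSpace.1 hC
  have : CompactSpace T.Disc := isCompact_iff_compactSpace.1 (isCompact_setOf_norm_snd_le 1)
  exact (isCompact_range T.isEmbedding.continuous).isClosed

/-- The factor by which a vector of length `r ≠ 0` has to be scaled in order to have length
`(1 - t) * r + t`. -/
noncomputable def stretch (t : I) (r : ℝ) : ℝ := (1 - t) + t * r⁻¹

theorem stretch_mul {t : I} {r : ℝ} (hr : r ≠ 0) : stretch t r * r = (1 - t) * r + t := by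
  rw [stretch, add_mul, inv_mul_cancel_right₀ hr]

theorem stretch_nonneg {t : I} {r : ℝ} (hr : 0 ≤ r) : 0 ≤ stretch t r :=
  add_nonneg (sub_nonneg.2 t.2.2) (mul_nonneg t.2.1 (inv_nonneg.2 hr))

theorem stretch_mul_le_one {t : I} {r : ℝ} (hr : r ≤ 1) : stretch t r * r ≤ 1 := by
  rcases eq_or_ne r 0 with rfl | h
  · simp
  · rw [stretch_mul h]
    nlinarith [t.2.2]

theorem norm_stretch_smul {E : Type*} [SeminormedAddCommGroup E] [NormedSpace ℝ E]
    (t : I) (v : E) :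
    ‖stretch t ‖v‖ • v‖ = stretch t ‖v‖ * ‖v‖ := by
  rw [norm_smul, Real.norm_of_nonneg (stretch_nonneg (norm_nonneg v))]

/-- The radial deformation of the disc bundle minus the zero section to the circle bundle. It fixes
the zero section, where it is not continuous. -/
noncomputable def pushDisc (t : I) (e : T.Disc) : T.Disc :=
  ⟨⟨e.1.1, stretch t (T.radius e) • e.1.2⟩,
    (norm_stretch_smul t e.1.2).trans_le (stretch_mul_le_one (T.radius_le_one e))⟩

theorem base_pushDisc (t : I) (e : T.Disc) : T.base (T.pushDisc t e) = T.base e := rfl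

theorem radius_pushDisc (t : I) {e : T.Disc} (he : T.radius e ≠ 0) :
    T.radius (T.pushDisc t e) = (1 - t) * T.radius e + t :=
  (norm_stretch_smul t e.1.2).trans (stretch_mul he)

theorem radius_pushDisc_ne_zero (t : I) {e : T.Disc} (he : T.radius e ≠ 0) :
    T.radius (T.pushDisc t e) ≠ 0 := by
  rw [radius_pushDisc T t he]
  have hpos : 0 < T.radius e := (T.radius_nonneg e).lt_of_ne' he
  nlinarith [t.2.1, t.2.2, T.radius_le_one e]

theorem pushDisc_zero (e : T.Disc) : T.pushDisc 0 e = e := by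
  simp [pushDisc, stretch]

theorem pushDisc_of_radius_eq_one (t : I) {e : T.Disc} (he : T.radius e = 1) :
    T.pushDisc t e = e := by
  simp [pushDisc, stretch, he]

theorem continuousOn_pushDisc :
    ContinuousOn (fun p : I × T.Disc => T.pushDisc p.1 p.2) (univ ×ˢ {e | T.radius e ≠ 0}) := by
  rw [IsEmbedding.subtypeVal.isInducing.continuousOn_iff]
  have hr : Continuous fun p : I × T.Disc => T.radius p.2 := T.continuous_radius.comp continuous_snd
  have hstretch : ContinuousOn (fun p : I × T.Disc => stretch p.1 (T.radius p.2))
      (univ ×ˢ {e | T.radius e ≠ 0}) := by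
    have ht : Continuous fun p : I × T.Disc => (p.1 : ℝ) :=
      continuous_subtype_val.comp continuous_fst
    exact (continuous_const.sub ht).continuousOn.add
      (ht.continuousOn.mul (hr.continuousOn.inv₀ fun _ h => h.2))
  exact continuous_smul_totalSpace.comp_continuousOn
    (hstretch.prodMk (continuous_subtype_val.comp continuous_snd).continuousOn)

/-- The radial deformation `pushDisc` as a deformation of the ambient space, fixing all points
outside the tubular neighbourhood. -/
noncomputable def push (t : I) : M → M := Function.extend T.emb (T.emb ∘ T.pushDisc t) id

theorem push_emb (t : I) (e : T.Disc) : T.push t (T.emb e) = T.emb (T.pushDisc t e) :=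
  T.emb_injective.extend_apply _ _ e

theorem push_of_notMem_closedTube (t : I) {z : M} (hz : z ∉ T.closedTube) : T.push t z = z :=
  Function.extend_apply' _ _ z hz

theorem push_of_notMem_openTube (t : I) {z : M} (hz : z ∉ T.openTube) : T.push t z = z := by
  by_cases h : z ∈ T.closedTube
  · obtain ⟨e, rfl⟩ := h
    rw [emb_mem_openTube_iff, not_lt] at hz
    rw [push_emb, pushDisc_of_radius_eq_one T t ((T.radius_le_one e).antisymm hz)]
  · exact T.push_of_notMem_closedTube t h

theorem push_zero (z : M) : T.push 0 z = z := by
  by_cases h : z ∈ T.closedTube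
  · obtain ⟨e, rfl⟩ := h
    rw [push_emb, pushDisc_zero]
  · exact T.push_of_notMem_closedTube 0 h

theorem push_one_notMem_openTube {z : M} (hz : z ∉ C) : T.push 1 z ∉ T.openTube := by
  by_cases h : z ∈ T.closedTube
  · obtain ⟨e, rfl⟩ := h
    rw [emb_mem_iff] at hz
    simp [push_emb, emb_mem_openTube_iff, radius_pushDisc T 1 hz]
  · rw [T.push_of_notMem_closedTube 1 h]
    exact fun hz => h (T.openTube_subset_closedTube hz)

theorem push_notMem (t : I) {z : M} (hz : z ∉ C) : T.push t z ∉ C := by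
  by_cases h : z ∈ T.closedTube
  · obtain ⟨e, rfl⟩ := h
    rw [emb_mem_iff] at hz
    rw [push_emb, emb_mem_iff]
    exact T.radius_pushDisc_ne_zero t hz
  · rwa [T.push_of_notMem_closedTube t h]

theorem continuousOn_push_closedTube :
    ContinuousOn (fun p : I × M => T.push p.1 p.2) (univ ×ˢ (Cᶜ ∩ T.closedTube)) := by
  have himage : (univ ×ˢ (Cᶜ ∩ T.closedTube) : Set (I × M)) =
      Prod.map id T.emb '' (univ ×ˢ {e | T.radius e ≠ 0}) := by
    rw [prodMap_image_prod, image_id, image_radius_ne_zero]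
  rw [himage, (IsInducing.id.prodMap T.isEmbedding.isInducing).continuousOn_image_iff]
  exact (T.isEmbedding.continuous.comp_continuousOn T.continuousOn_pushDisc).congr
    fun p _ => T.push_emb p.1 p.2

theorem continuousOn_push_compl_openTube :
    ContinuousOn (fun p : I × M => T.push p.1 p.2) (univ ×ˢ T.openTubeᶜ) :=
  continuousOn_snd.congr fun p hp => T.push_of_notMem_openTube p.1 hp.2

theorem continuousOn_push (hT : IsClosed T.closedTube) :
    ContinuousOn (fun p : I × M => T.push p.1 p.2) (univ ×ˢ Cᶜ) := by
  refine continuousOn_of_subset_union_isClosed (isClosed_univ.prod hT)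
    (isClosed_univ.prod T.isOpen_image.isClosed_compl) ?_ ?_ ?_
  · rw [← prod_union, union_comm]
    exact prod_mono_right fun z _ => (em (z ∈ T.openTube)).symm.imp_right
      (T.openTube_subset_closedTube ·)
  · rw [← prod_inter]
    exact T.continuousOn_push_closedTube
  · exact T.continuousOn_push_compl_openTube.mono inter_subset_right

/-- The part of `A` in the tubular neighbourhood is a union of fibres of the projection of the disc
bundle. -/
def IsSaturated (A : Set M) : Prop :=
  ∀ ⦃e e' : T.Disc⦄, T.base e = T.base e' → T.emb e ∈ A → T.emb e' ∈ A

variable {T} {A : Set M}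

theorem isSaturated_of_closedTube_subset (hA : T.closedTube ⊆ A) : T.IsSaturated A :=
  fun _ e' _ _ => hA (mem_range_self e')

theorem IsSaturated.base_mem_iff (hA : T.IsSaturated A) (e : T.Disc) :
    T.base e ∈ A ↔ T.emb e ∈ A := by
  rw [show T.base e = T.emb (T.zero e.1.1) from (T.emb_zero_apply e.1.1).symm]
  have hbase : T.base (T.zero e.1.1) = T.base e := rfl
  exact ⟨hA hbase, hA hbase.symm⟩

theorem IsSaturated.push_mem_iff (hA : T.IsSaturated A) (t : I) {z : M} :
    T.push t z ∈ A ↔ z ∈ A := by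
  by_cases h : z ∈ T.closedTube
  · obtain ⟨e, rfl⟩ := h
    rw [push_emb]
    exact ⟨fun h => hA (T.base_pushDisc t e) h, fun h => hA (T.base_pushDisc t e).symm h⟩
  · rw [T.push_of_notMem_closedTube t h]

end TubularNbhd

namespace IsBidiscChart

variable {M : Type*} [TopologicalSpace M] {C C' : Set M} {T : TubularNbhd C} {T' : TubularNbhd C'}
  {q : M} {N : Set M} {g : ClosedDisc × ClosedDisc → M}

theorem apply_mem (hg : IsBidiscChart T T' q N g) (p : ClosedDisc × ClosedDisc) : g p ∈ N :=
  hg.range_eq ▸ mem_range_self p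

theorem exists_emb_eq_of_base_eq (hg : IsBidiscChart T T' q N g) {e e' : T.Disc} {x y : ClosedDisc}
    (hbase : T.base e = T.base e') (he : T.emb e = g (x, y)) : ∃ y', T.emb e' = g (x, y') := by
  have hx : T.base e' = g (x, ClosedDisc.centre) := hbase.symm.trans (hg.base_left e x y he)
  have he' : T.emb e' ∈ range g :=
    hg.range_eq ▸ hg.saturated_left e' (hx ▸ hg.apply_mem (x, ClosedDisc.centre))
  obtain ⟨⟨x', y'⟩, hxy'⟩ := he'
  have hx' : g (x', ClosedDisc.centre) = g (x, ClosedDisc.centre) :=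
    (hg.base_left e' x' y' hxy'.symm).symm.trans hx
  obtain rfl : x' = x := congrArg Prod.fst (hg.isEmbedding.injective hx')
  exact ⟨y', hxy'.symm⟩

theorem mem_openTube_right_iff (hg : IsBidiscChart T T' q N g) (hN : N ⊆ T'.closedTube)
    (x y : ClosedDisc) : g (x, y) ∈ T'.openTube ↔ ‖(x : ℂ)‖ < 1 := by
  obtain ⟨e, he⟩ := hN (hg.apply_mem (x, y))
  rw [← he, TubularNbhd.emb_mem_openTube_iff, (T'.radius_le_one e).lt_iff_ne, x.2.lt_iff_ne,
    ne_eq, ne_eq, hg.radius_right e x y he]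

end IsBidiscChart

namespace TubularSystem

variable {M : Type*} [TopologicalSpace M] {ι : Type*} {C : ι → Set M} (T : TubularSystem C)
  {i j : ι}

theorem exists_chart (hij : i ≠ j) {z : M} (hi : z ∈ (T.tube i).closedTube)
    (hj : z ∈ (T.tube j).closedTube) : ∃ q g, IsBidiscChart (T.tube i) (T.tube j) q (T.N q) g ∧
      T.N q ⊆ (T.tube j).closedTube ∧ z ∈ range g := by
  have hz : z ∈ ⋃ q ∈ C i ∩ C j, T.N q := T.tube_inter i j hij ▸ ⟨hi, hj⟩
  obtain ⟨q, hq, hzq⟩ := mem_iUnion₂.1 hz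
  obtain ⟨g, hg⟩ := T.chart i j hij q hq
  refine ⟨q, g, hg, ?_, hg.range_eq ▸ hzq⟩
  exact (subset_biUnion_of_mem (u := T.N) hq).trans
    ((T.tube_inter i j hij).symm.subset.trans inter_subset_right)

theorem isSaturated_of_forall_chart (hij : i ≠ j) {A : Set M} (hA : A ⊆ (T.tube j).closedTube)
    (hchart : ∀ q g, IsBidiscChart (T.tube i) (T.tube j) q (T.N q) g →
      T.N q ⊆ (T.tube j).closedTube → ∀ x y y', g (x, y) ∈ A → g (x, y') ∈ A) :
    (T.tube i).IsSaturated A := by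
  intro e e' hbase he
  obtain ⟨q, g, hg, hN, ⟨x, y⟩, hxy⟩ := T.exists_chart hij (mem_range_self e) (hA he)
  obtain ⟨y', hxy'⟩ := hg.exists_emb_eq_of_base_eq hbase hxy.symm
  rw [hxy']
  exact hchart q g hg hN x y y' (hxy ▸ he)

theorem isSaturated_openTube (hij : i ≠ j) : (T.tube i).IsSaturated (T.tube j).openTube :=
  T.isSaturated_of_forall_chart hij (T.tube j).openTube_subset_closedTube
    fun q g hg hN x y y' h => by rwa [hg.mem_openTube_right_iff hN] at h ⊢

theorem isSaturated_curve (hij : i ≠ j) : (T.tube i).IsSaturated (C j) :=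
  T.isSaturated_of_forall_chart hij
    ((T.tube j).subset_openTube.trans (T.tube j).openTube_subset_closedTube)
    fun q g hg _ x y y' h => by rwa [hg.mem_right] at h ⊢

theorem base_mem_core_iff {e : (T.tube i).Disc} :
    (T.tube i).base e ∈ T.core i ↔ ∀ j, j ≠ i → (T.tube i).emb e ∉ (T.tube j).openTube := by
  have hbase : (T.tube i).base e ∈ C i := e.1.1.2
  simp only [core, mem_sdiff, hbase, true_and, mem_iUnion, mem_inter_iff,
    (T.tube i).subset_openTube hbase, exists_prop, not_exists, not_and]
  exact forall₂_congr fun j hji => ((T.isSaturated_openTube hji.symm).base_mem_iff e).not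

theorem boundary_eq : T.boundary = T.nbhd \ ⋃ i, (T.tube i).openTube := by
  ext z
  simp only [boundary, nbhd, mem_sdiff, mem_iUnion, not_exists]
  constructor
  · rintro ⟨i, e, ⟨hr, hcore⟩, rfl⟩
    refine ⟨⟨i, mem_range_self e⟩, fun j => ?_⟩
    rcases eq_or_ne j i with rfl | hji
    · exact (T.tube j).emb_mem_openTube_iff.not.2 hr.not_lt
    · exact T.base_mem_core_iff.1 hcore j hji
  · rintro ⟨⟨i, e, rfl⟩, hz⟩
    refine ⟨i, e, ⟨?_, T.base_mem_core_iff.2 fun j _ => hz j⟩, rfl⟩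
    exact ((T.tube i).radius_le_one e).antisymm
      (not_lt.1 ((T.tube i).emb_mem_openTube_iff.not.1 (hz i)))

/-- The complement `T(V) ∖ V` of the curve in its tubular neighbourhood. -/
abbrev puncturedNbhd : Set M := T.nbhd \ ⋃ i, C i

theorem boundary_subset_puncturedNbhd : T.boundary ⊆ T.puncturedNbhd :=
  T.boundary_eq.trans_subset <|
    sdiff_subset_sdiff_right (iUnion_mono fun i => (T.tube i).subset_openTube)

theorem preimage_boundary_eq_iInter :
    ((↑) ⁻¹' T.boundary : Set T.puncturedNbhd) = ⋂ i, (↑) ⁻¹' (T.tube i).openTubeᶜ := by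
  ext x
  simp [boundary_eq, x.2.1]

theorem push_mem_puncturedNbhd (i : ι) (t : I) {z : M} (hz : z ∈ T.puncturedNbhd) :
    (T.tube i).push t z ∈ T.puncturedNbhd := by
  have hnbhd : (T.tube i).IsSaturated T.nbhd :=
    TubularNbhd.isSaturated_of_closedTube_subset (subset_iUnion_of_subset i subset_rfl)
  refine ⟨(hnbhd.push_mem_iff t).2 hz.1, fun hmem => ?_⟩
  obtain ⟨j, hj⟩ := mem_iUnion.1 hmem
  have hzj : z ∉ C j := fun h => hz.2 (mem_iUnion.2 ⟨j, h⟩)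
  rcases eq_or_ne i j with rfl | hij
  · exact (T.tube i).push_notMem t hzj hj
  · exact hzj (((T.isSaturated_curve hij).push_mem_iff t).1 hj)

/-- The radial deformation of the `i`-th tubular neighbourhood, as a deformation of `T(V) ∖ V`. -/
noncomputable def pushHomotopy (i : ι) (hT : IsClosed (T.tube i).closedTube) :
    C(I × T.puncturedNbhd, T.puncturedNbhd) where
  toFun p := ⟨(T.tube i).push p.1 p.2, T.push_mem_puncturedNbhd i p.1 p.2.2⟩
  continuous_toFun := by
    refine Continuous.subtype_mk (((T.tube i).continuousOn_push hT).comp_continuous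
      (f := fun p : I × T.puncturedNbhd => (p.1, (p.2 : M))) (by fun_prop) fun p => ?_) _
    exact ⟨mem_univ _, fun h => p.2.2.2 (mem_iUnion.2 ⟨i, h⟩)⟩

theorem isStrongDeformation_pushHomotopy (i : ι) (hT : IsClosed (T.tube i).closedTube) :
    IsStrongDeformation ((↑) ⁻¹' (T.tube i).openTubeᶜ) (T.pushHomotopy i hT) where
  map_zero x := Subtype.ext ((T.tube i).push_zero x)
  map_one_mem x := (T.tube i).push_one_notMem_openTube fun h => x.2.2 (mem_iUnion.2 ⟨i, h⟩)
  map_eq_self t _ hx := Subtype.ext ((T.tube i).push_of_notMem_openTube t hx)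

theorem mapsTo_pushHomotopy (hij : i ≠ j) (hT : IsClosed (T.tube i).closedTube) (t : I) :
    MapsTo (fun x => T.pushHomotopy i hT (t, x)) ((↑) ⁻¹' (T.tube j).openTubeᶜ)
      ((↑) ⁻¹' (T.tube j).openTubeᶜ) :=
  fun _ hx => ((T.isSaturated_openTube hij).push_mem_iff t).not.2 hx

end TubularSystem

theorem eval_smul_of_isHomogeneous {ι R : Type*} [CommSemiring R] {f : MvPolynomial ι R} {d : ℕ}
    (hf : f.IsHomogeneous d) (a : R) (v : ι → R) :
    MvPolynomial.eval (a • v) f = a ^ d * MvPolynomial.eval v f := by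
  rw [MvPolynomial.eval_eq, MvPolynomial.eval_eq, Finset.mul_sum]
  refine Finset.sum_congr rfl fun m hm => ?_
  have hd : ∑ i ∈ m.support, m i = d := by
    rw [← Finsupp.degree_apply, Finsupp.degree_eq_weight_one]
    exact hf (MvPolynomial.mem_support_iff.1 hm)
  simp only [Pi.smul_apply, smul_eq_mul, mul_pow, Finset.prod_mul_distrib,
    Finset.prod_pow_eq_pow_sum, hd]
  ring

namespace PSpace

variable {n : ℕ}

theorem isQuotientMap_mk' :
    IsQuotientMap (Projectivization.mk' ℂ : {v : Fin (n + 1) → ℂ // v ≠ 0} → PSpace n) :=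
  ⟨⟨rfl⟩, Quotient.mk''_surjective⟩

theorem isOpenMap_mk' :
    IsOpenMap (Projectivization.mk' ℂ : {v : Fin (n + 1) → ℂ // v ≠ 0} → PSpace n) := by
  intro U hU
  let scale (a : ℂˣ) (v : {v : Fin (n + 1) → ℂ // v ≠ 0}) : {v : Fin (n + 1) → ℂ // v ≠ 0} :=
    ⟨a • v.1, (smul_ne_zero_iff_ne a).2 v.2⟩
  have hscale (a : ℂˣ) : Continuous (scale a) :=
    (continuous_subtype_val.const_smul a).subtype_mk _
  have hpreimage : Projectivization.mk' ℂ ⁻¹' (Projectivization.mk' ℂ '' U) =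
      ⋃ a, scale a ⁻¹' U := by
    ext v
    simp only [mem_preimage, mem_image, mem_iUnion, Projectivization.mk'_eq_mk,
      Projectivization.mk_eq_mk_iff]
    constructor
    · rintro ⟨w, hw, a, ha⟩
      exact ⟨a, (Subtype.ext ha : scale a v = w) ▸ hw⟩
    · rintro ⟨a, ha⟩
      exact ⟨scale a v, ha, a, rfl⟩
  rw [← isQuotientMap_mk'.isOpen_preimage, hpreimage]
  exact isOpen_iUnion fun a => hU.preimage (hscale a)

instance : T2Space (PSpace n) := by
  rw [t2Space_iff_of_isOpenQuotientMap
    (IsOpenQuotientMap.of_isOpenMap_isQuotientMap isOpenMap_mk' isQuotientMap_mk')]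
  simp only [Projectivization.mk'_eq_mk, ← Projectivization.dependent_pair_iff_eq,
    Projectivization.dependent_iff_not_independent,
    Projectivization.independent_mk_iff_LinearIndependent]
  exact (isOpen_setOfPred_linearIndependent (𝕜 := ℂ)).isClosed_compl.preimage
    (f := fun q : {v : Fin (n + 1) → ℂ // v ≠ 0} × {v : Fin (n + 1) → ℂ // v ≠ 0} =>
      ![q.1.1, q.2.1]) (by fun_prop)

instance : CompactSpace (PSpace n) := by
  let ofSphere (v : Metric.sphere (0 : Fin (n + 1) → ℂ) 1) : {v : Fin (n + 1) → ℂ // v ≠ 0} :=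
    ⟨v.1, ne_zero_of_mem_unit_sphere v⟩
  have hcont : Continuous ofSphere := continuous_subtype_val.subtype_mk _
  refine Function.Surjective.compactSpace (f := Projectivization.mk' ℂ ∘ ofSphere)
    (isQuotientMap_mk'.continuous.comp hcont) fun p => ?_
  obtain ⟨⟨v, hv⟩, rfl⟩ := isQuotientMap_mk'.surjective p
  refine ⟨⟨(‖v‖⁻¹ : ℂ) • v, by simp [norm_smul, hv]⟩, ?_⟩
  exact (Projectivization.mk_eq_mk_iff' ℂ _ _ _ _).2 ⟨_, rfl⟩

theorem vanishesAt_mk_iff {f : MvPolynomial (Fin (n + 1)) ℂ} (hf : IsForm f)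
    {v : Fin (n + 1) → ℂ} (hv : v ≠ 0) :
    VanishesAt f (Projectivization.mk ℂ v hv) ↔ MvPolynomial.eval v f = 0 := by
  obtain ⟨d, hd⟩ := hf
  obtain ⟨a, ha⟩ := Projectivization.exists_smul_eq_mk_rep ℂ v hv
  rw [VanishesAt, ← ha, Units.smul_def, eval_smul_of_isHomogeneous hd, mul_eq_zero]
  simp

end PSpace

theorem IsProjAlgebraic.isClosed {n : ℕ} {Z : Set (PSpace n)} (hZ : IsProjAlgebraic Z) :
    IsClosed Z := by
  obtain ⟨S, hS, rfl⟩ := hZ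
  have hpreimage : Projectivization.mk' ℂ ⁻¹' {p : PSpace n | ∀ f ∈ S, VanishesAt f p} =
      ⋂ f ∈ S, {v : {v : Fin (n + 1) → ℂ // v ≠ 0} | MvPolynomial.eval v.1 f = 0} := by
    ext v
    simp only [mem_preimage, mem_ofPred_eq, mem_iInter]
    exact forall₂_congr fun f hf => PSpace.vanishesAt_mk_iff (hS f hf) v.2
  rw [← PSpace.isQuotientMap_mk'.isClosed_preimage, hpreimage]
  exact isClosed_biInter fun f _ => isClosed_eq
    ((MvPolynomial.continuous_eval f).comp continuous_subtype_val) continuous_const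

theorem IsNormalCrossingCurve.isCompact {n k : ℕ} {X : Set (PSpace n)} {C : Fin k → Set X}
    (hC : IsNormalCrossingCurve X C) (i : Fin k) : IsCompact (C i) :=
  Subtype.isCompact_iff.2 (hC.smooth i).1.isClosed.isCompact

theorem lemma3p1_general {M ι : Type*} [TopologicalSpace M] [Finite ι] {C : ι → Set M}
    (T : TubularSystem C) (hT : ∀ i, IsClosed (T.tube i).closedTube) :
    HasDeformationRetraction (T.nbhd \ ⋃ i, C i) T.boundary := by
  obtain ⟨H, hH⟩ := IsStrongDeformation.exists_iInter
    (fun i => T.isStrongDeformation_pushHomotopy i (hT i))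
    (fun i j hij => T.mapsTo_pushHomotopy hij (hT i))
  rw [← T.preimage_boundary_eq_iInter] at hH
  exact hH.hasDeformationRetraction T.boundary_subset_puncturedNbhd

theorem lemma3p1 {n k : ℕ} (X : Set (PSpace n)) (hX : IsSmoothProjective 2 X)
    (C : Fin k → Set X) (hC : IsNormalCrossingCurve X C) (T : TubularSystem C) :
    HasDeformationRetraction (T.nbhd \ ⋃ i, C i) T.boundary :=
  lemma3p1_general T fun i => (T.tube i).isClosed_closedTube (hC.isCompact i)
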